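/- Let $E$ be a (real) Banach lattice that is Arens regular, i.e. every bounded linear operator $T\colon E\to E^*$ is weakly compact (the image of the closed unit ball of $E$ is relatively weakly compact in $E^*$). Then, for every Banach lattice $F$, every $m$ and every regular $m$-linear operator $A\colon E^m\to F$ (a difference of two positive $m$-linear operators, where an $m$-linear operator $P$ is positive if $P(x_1,\dots,x_m)\ge 0$ whenever $x_1,\dots,x_m\ge 0$), the Arens extension $A^{*[m+1]}\colon (E^{**})^m\to F^{**}$ is separately order continuous on $(E^{**})^m$. Here the extension is defined as follows. For $x^{**}\in E^{**}$, $k\ge 1$ and a continuous $k$-linear form $B$ on $E^k$, let $\overline{x^{**}}(B)$ be the $(k-1)$-linear form $(x_1,\dots,x_{k-1})\mapsto x^{**}\bigl(B(x_1,\dots,x_{k-1},\,\bullet\,)\bigr)$ (a scalar if $k=1$); then $$A^{*[m+1]}(x_1^{**},\dots,x_m^{**})(y^*)=\bigl(\overline{x_1^{**}}\circ\overline{x_2^{**}}\circ\cdots\circ\overline{x_m^{**}}\bigr)(y^*\circ A)\qquad(y^*\in F^*).$$ (A regular $m$-linear operator between Banach lattices is automatically continuous, so this makes sense.) Duals carry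 the dual order ($f\le g$ iff $f(x)\le g(x)$ for all $x\ge 0$), for which they are Banach lattices. A net $(x_\alpha)_{\alpha\in\Omega}$ in a Riesz space is order convergent to $x$ if there is a net $(y_\alpha)_{\alpha\in\Omega}$, indexed by the same directed set, with $y_\alpha\downarrow 0$ and $|x_\alpha-x|\le y_\alpha$ for all $\alpha$; a linear operator between Riesz spaces is order continuous if it maps nets that are order convergent to $0$ to nets that are order convergent to $0$; and an $m$-linear operator is separately order continuous if, for each $j$ and each choice of the other $m-1$ arguments, it is order continuous as a linear operator of its $j$-th argument. -/

import Mathlib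

universe w u v

set_option linter.unusedSectionVars false

open Set Filter Topology

noncomputable section


/-! ### The dual of a normed lattice -/

namespace DualLattice

variable {E : Type*} [NormedAddCommGroup E] [NormedSpace ℝ E] [Lattice E]
  [IsOrderedAddMonoid E] [HasSolidNorm E]

/-- The dual order: `f ≤ g` iff `f x ≤ g x` for all `x ≥ 0`. -/
instance instPartialOrder : PartialOrder (StrongDual ℝ E) where
  le f g := ∀ x : E, 0 ≤ x → f x ≤ g x
  le_refl _ _ _ := le_rfl
  le_trans _ _ _ h₁ h₂ x hx := (h₁ x hx).trans (h₂ x hx)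
  le_antisymm f g h₁ h₂ := by
    have key : ∀ x : E, 0 ≤ x → f x = g x := fun x hx => le_antisymm (h₁ x hx) (h₂ x hx)
    ext x
    rw [← posPart_sub_negPart x, map_sub, map_sub, key _ (posPart_nonneg x),
      key _ (negPart_nonneg x)]

theorem le_iff {f g : StrongDual ℝ E} : f ≤ g ↔ ∀ x : E, 0 ≤ x → f x ≤ g x := Iff.rfl

instance instIsOrderedAddMonoid : IsOrderedAddMonoid (StrongDual ℝ E) where
  add_le_add_left f g h k x hx := by
    simpa using h x hx

instance instIsOrderedModule : IsOrderedModule ℝ (StrongDual ℝ E) where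
  smul_le_smul_of_nonneg_left c hc f g h x hx := by
    simpa using mul_le_mul_of_nonneg_left (h x hx) hc
  smul_le_smul_of_nonneg_right f hf c d h x hx := by
    simpa using mul_le_mul_of_nonneg_right h (by simpa using hf x hx)

/-- `f⁺(x) = sup {f y : 0 ≤ y ≤ x}` for `x ≥ 0`. -/
def posSup (f : StrongDual ℝ E) (x : E) : ℝ := sSup (f '' Icc 0 x)

theorem apply_le_of_mem (f : StrongDual ℝ E) {x y : E} (hy : y ∈ Icc 0 x) :
    f y ≤ ‖f‖ * ‖x‖ := by
  refine (le_abs_self _).trans ((f.le_opNorm y).trans ?_)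
  refine mul_le_mul_of_nonneg_left ?_ (norm_nonneg f)
  refine norm_le_norm_of_abs_le_abs ?_
  rw [abs_of_nonneg hy.1, abs_of_nonneg (hy.1.trans hy.2)]
  exact hy.2

theorem bddAbove_image (f : StrongDual ℝ E) (x : E) : BddAbove (f '' Icc 0 x) :=
  ⟨‖f‖ * ‖x‖, by rintro _ ⟨y, hy, rfl⟩; exact apply_le_of_mem f hy⟩

theorem le_posSup (f : StrongDual ℝ E) {x y : E} (hy : y ∈ Icc 0 x) : f y ≤ posSup f x :=
  le_csSup (bddAbove_image f x) ⟨y, hy, rfl⟩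

theorem posSup_le (f : StrongDual ℝ E) {x : E} (hx : 0 ≤ x) {c : ℝ}
    (h : ∀ y ∈ Icc 0 x, f y ≤ c) : posSup f x ≤ c :=
  csSup_le ⟨_, 0, ⟨le_rfl, hx⟩, rfl⟩ (by rintro _ ⟨y, hy, rfl⟩; exact h y hy)

theorem posSup_nonneg (f : StrongDual ℝ E) {x : E} (hx : 0 ≤ x) : 0 ≤ posSup f x := by
  simpa using le_posSup f (⟨le_rfl, hx⟩ : (0 : E) ∈ Icc 0 x)

theorem posSup_add (f : StrongDual ℝ E) {x y : E} (hx : 0 ≤ x) (hy : 0 ≤ y) :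
    posSup f (x + y) = posSup f x + posSup f y := by
  apply le_antisymm
  · refine posSup_le f (add_nonneg hx hy) fun z hz => ?_
    have h1 : z ⊓ x ∈ Icc 0 x := ⟨le_inf hz.1 hx, inf_le_right⟩
    have h2 : z - z ⊓ x ∈ Icc 0 y := by
      refine ⟨sub_nonneg.2 inf_le_left, ?_⟩
      rw [sub_le_iff_le_add, ← sub_le_iff_le_add']
      exact le_inf ((sub_le_self_iff z).2 hy) (sub_le_iff_le_add.2 hz.2)
    have h3 : f z = f (z ⊓ x) + f (z - z ⊓ x) := by rw [← map_add]; congr 1; abel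
    rw [h3]
    exact add_le_add (le_posSup f h1) (le_posSup f h2)
  · rw [← le_sub_iff_add_le]
    refine posSup_le f hx fun a ha => ?_
    rw [le_sub_comm]
    refine posSup_le f hy fun b hb => ?_
    rw [le_sub_iff_add_le', ← map_add]
    exact le_posSup f ⟨add_nonneg ha.1 hb.1, add_le_add ha.2 hb.2⟩

theorem posSup_sub_congr (f : StrongDual ℝ E) {a b c d : E} (ha : 0 ≤ a) (hb : 0 ≤ b)
    (hc : 0 ≤ c) (hd : 0 ≤ d) (h : a - b = c - d) :
    posSup f a - posSup f b = posSup f c - posSup f d := by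
  have h' : a + d = c + b := sub_eq_sub_iff_add_eq_add.1 h
  have := congrArg (posSup f) h'
  rw [posSup_add f ha hd, posSup_add f hc hb] at this
  linarith

/-- The additive extension of `posSup f` to the whole space. -/
def posAddHom (f : StrongDual ℝ E) : E →+ ℝ :=
  AddMonoidHom.mk' (fun x => posSup f x⁺ - posSup f x⁻) fun x y => by
    have h := posSup_sub_congr f (posPart_nonneg (x + y)) (negPart_nonneg (x + y))
      (add_nonneg (posPart_nonneg x) (posPart_nonneg y))
      (add_nonneg (negPart_nonneg x) (negPart_nonneg y)) (by
        rw [add_sub_add_comm, posPart_sub_negPart, posPart_sub_negPart, posPart_sub_negPart])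
    rw [h, posSup_add f (posPart_nonneg x) (posPart_nonneg y),
      posSup_add f (negPart_nonneg x) (negPart_nonneg y)]
    ring

theorem posAddHom_bound (f : StrongDual ℝ E) (x : E) : ‖posAddHom f x‖ ≤ ‖f‖ * ‖x‖ := by
  have hp : ∀ y : E, 0 ≤ y → |y| ≤ |x| → posSup f y ≤ ‖f‖ * ‖x‖ := fun y hy hyx =>
    (posSup_le f hy fun _ hz => apply_le_of_mem f hz).trans
      (mul_le_mul_of_nonneg_left (norm_le_norm_of_abs_le_abs hyx) (norm_nonneg f))
  have h1 := hp x⁺ (posPart_nonneg x) (by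
    rw [abs_of_nonneg (posPart_nonneg x), ← posPart_add_negPart x]
    exact le_add_of_nonneg_right (negPart_nonneg x))
  have h2 := hp x⁻ (negPart_nonneg x) (by
    rw [abs_of_nonneg (negPart_nonneg x), ← posPart_add_negPart x]
    exact le_add_of_nonneg_left (posPart_nonneg x))
  have h3 := posSup_nonneg f (posPart_nonneg x)
  have h4 := posSup_nonneg f (negPart_nonneg x)
  change |posSup f x⁺ - posSup f x⁻| ≤ _
  rw [abs_le]
  constructor <;> linarith

/-- The positive part of a functional (Riesz--Kantorovich). -/
def pos (f : StrongDual ℝ E) : StrongDual ℝ E :=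
  (posAddHom f).toRealLinearMap (AddMonoidHomClass.continuous_of_bound _ ‖f‖ (posAddHom_bound f))

theorem pos_apply (f : StrongDual ℝ E) {x : E} (hx : 0 ≤ x) : pos f x = posSup f x := by
  change posSup f x⁺ - posSup f x⁻ = _
  have h := posSup_sub_congr f (posPart_nonneg x) (negPart_nonneg x) hx le_rfl (by simp)
  have h0 : posSup f (0 : E) = 0 := by
    have := posSup_add f (le_refl (0 : E)) le_rfl
    simpa using this
  rw [h, h0, sub_zero]

theorem le_pos (f : StrongDual ℝ E) : f ≤ pos f := fun x hx => by
  rw [pos_apply f hx]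
  exact le_posSup f ⟨hx, le_rfl⟩

theorem pos_nonneg (f : StrongDual ℝ E) : 0 ≤ pos f := fun x hx => by
  rw [pos_apply f hx]
  exact posSup_nonneg f hx

theorem pos_le {f g : StrongDual ℝ E} (h : f ≤ g) (hg : 0 ≤ g) : pos f ≤ g := fun x hx => by
  rw [pos_apply f hx]
  refine posSup_le f hx fun y hy => (h y hy.1).trans ?_
  have := hg (x - y) (sub_nonneg.2 hy.2)
  simpa using this

/-- The dual of a normed lattice is a lattice for the dual order. -/
instance instLattice : Lattice (StrongDual ℝ E) where
  __ := instPartialOrder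
  sup f g := g + pos (f - g)
  inf f g := f - pos (f - g)
  le_sup_left f g := by
    rw [← sub_le_iff_le_add']
    exact le_pos (f - g)
  le_sup_right f g := le_add_of_nonneg_right (pos_nonneg (f - g))
  sup_le f g h hf hg := by
    rw [← le_sub_iff_add_le']
    exact pos_le (sub_le_sub_right hf g) (sub_nonneg.2 hg)
  inf_le_left f g := sub_le_self f (pos_nonneg (f - g))
  inf_le_right f g := by
    rw [sub_le_comm]
    exact le_pos (f - g)
  le_inf h f g hf hg := by
    rw [le_sub_comm]
    exact pos_le (sub_le_sub_left hg f) (sub_nonneg.2 hf)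

theorem sup_def (f g : StrongDual ℝ E) : f ⊔ g = g + pos (f - g) := rfl

theorem abs_apply_le (f : StrongDual ℝ E) (x : E) : |f x| ≤ |f| |x| := by
  have h : ∀ y : E, 0 ≤ y → |f y| ≤ |f| y := fun y hy =>
    abs_le'.2 ⟨le_abs_self f y hy, by simpa using neg_le_abs f y hy⟩
  have h1 : f x = f x⁺ - f x⁻ := by rw [← map_sub, posPart_sub_negPart]
  rw [h1, ← posPart_add_negPart x, map_add]
  exact (abs_sub _ _).trans
    (add_le_add (h _ (posPart_nonneg x)) (h _ (negPart_nonneg x)))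

theorem abs_apply_le_norm (f : StrongDual ℝ E) {x : E} (hx : 0 ≤ x) :
    |f| x ≤ ‖f‖ * ‖x‖ := by
  have h0 : |f| = -f + pos (f - -f) := rfl
  rw [h0, _root_.add_apply, pos_apply _ hx, ← le_sub_iff_add_le']
  refine posSup_le _ hx fun y hy => ?_
  rw [le_sub_iff_add_le']
  have h1 : (-f) x + (f - -f) y = f (y + y - x) := by
    simp only [_root_.neg_apply, _root_.sub_apply, map_sub, map_add]
    ring
  rw [h1]
  refine (le_abs_self _).trans ((f.le_opNorm _).trans ?_)
  refine mul_le_mul_of_nonneg_left (norm_le_norm_of_abs_le_abs ?_) (norm_nonneg f)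
  rw [abs_of_nonneg hx, abs_le']
  constructor
  · rw [sub_le_iff_le_add]
    exact add_le_add hy.2 hy.2
  · rw [neg_sub]
    exact sub_le_self x (add_nonneg hy.1 hy.1)

/-- The dual norm is a lattice norm, so the dual of a Banach lattice is a Banach lattice. -/
instance instHasSolidNorm : HasSolidNorm (StrongDual ℝ E) where
  solid f g h := by
    refine f.opNorm_le_bound (norm_nonneg g) fun x => ?_
    calc ‖f x‖ ≤ |f| |x| := abs_apply_le f x
      _ ≤ |g| |x| := h _ (abs_nonneg x)
      _ ≤ ‖g‖ * ‖|x|‖ := abs_apply_le_norm g (abs_nonneg x)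
      _ = ‖g‖ * ‖x‖ := by rw [norm_abs_eq_norm]

end DualLattice

/-! ### Order continuity -/

section OrderContinuity

variable {X Y : Type*} [AddCommGroup X] [Lattice X] [AddCommGroup Y] [Lattice Y]

/-- The net `y` decreases to `0`: it is decreasing with infimum `0`. -/
def DecreasesToZero {Ω : Type*} [Preorder Ω] (y : Ω → X) : Prop :=
  Antitone y ∧ IsGLB (range y) 0

/-- Order convergence of the net `x` to `a`. -/
def OrderConvergent {Ω : Type*} [Preorder Ω] (x : Ω → X) (a : X) : Prop :=
  ∃ y : Ω → X, DecreasesToZero y ∧ ∀ α, |x α - a| ≤ y α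

/-- A linear operator is order continuous if it sends nets that are order convergent to zero to
nets that are order convergent to zero (nets indexed by directed sets in `Type w`). -/
def IsOrderContinuous [Module ℝ X] [Module ℝ Y] (T : X →ₗ[ℝ] Y) : Prop :=
  ∀ (Ω : Type w) [Preorder Ω] [IsDirectedOrder Ω] [Nonempty Ω] (x : Ω → X),
    OrderConvergent x 0 → OrderConvergent (fun α => T (x α)) 0

/-- Separate order continuity: for all `j` and all `x`, the linear operator
`t ↦ A (x₁, …, x_{j-1}, t, x_{j+1}, …, x_m)` is order continuous. -/
def IsSeparatelyOrderContinuous [Module ℝ X] [Module ℝ Y] {m : ℕ}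
    (A : MultilinearMap ℝ (fun _ : Fin m => X) Y) : Prop :=
  ∀ (j : Fin m) (x : Fin m → X), IsOrderContinuous.{w} (A.toLinearMap x j)

end OrderContinuity

/-! ### Regular multilinear operators -/

section Regular

variable {E F : Type*} [NormedAddCommGroup E] [NormedSpace ℝ E] [Lattice E]
  [NormedAddCommGroup F] [NormedSpace ℝ F] [Lattice F] {m : ℕ}

/-- An `m`-linear operator is positive if it is `≥ 0` at positive arguments. -/
def IsPositiveMultilinear (A : MultilinearMap ℝ (fun _ : Fin m => E) F) : Prop :=
  ∀ x : Fin m → E, (∀ i, 0 ≤ x i) → 0 ≤ A x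

/-- An `m`-linear operator is regular if it is the difference of two positive ones. -/
def IsRegularMultilinear (A : MultilinearMap ℝ (fun _ : Fin m => E) F) : Prop :=
  ∃ P N : MultilinearMap ℝ (fun _ : Fin m => E) F,
    IsPositiveMultilinear P ∧ IsPositiveMultilinear N ∧ A = P - N

variable [IsOrderedAddMonoid E] [IsOrderedModule ℝ E] [HasSolidNorm E] [CompleteSpace E]
  [IsOrderedAddMonoid F] [HasSolidNorm F]

theorem IsPositiveMultilinear.mono {P : MultilinearMap ℝ (fun _ : Fin m => E) F}
    (hP : IsPositiveMultilinear P) {x y : Fin m → E} (hx : ∀ i, 0 ≤ x i)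
    (hxy : ∀ i, x i ≤ y i) : P x ≤ P y := by
  classical
  have h : P y = ∑ s : Finset (Fin m), P (s.piecewise x (y - x)) := by
    rw [← P.map_add_univ]; congr 1; abel
  rw [h]
  have h1 := Finset.single_le_sum
    (f := fun s : Finset (Fin m) => P (s.piecewise x (y - x))) (s := Finset.univ)
    (fun s _ => hP _ fun i => by
      by_cases hi : i ∈ s
      · simpa [hi] using hx i
      · simpa [hi] using hxy i) (Finset.mem_univ (Finset.univ : Finset (Fin m)))
  simpa using h1

theorem IsPositiveMultilinear.bound_pos {P : MultilinearMap ℝ (fun _ : Fin m => E) F}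
    (hP : IsPositiveMultilinear P) :
    ∃ C : ℝ, ∀ x : Fin m → E, (∀ i, 0 ≤ x i) → (∀ i, ‖x i‖ ≤ 1) → ‖P x‖ ≤ C := by
  by_contra! hcon
  choose x hx0 hx1 hx using fun n : ℕ => hcon (n * (2 ^ n) ^ m)
  have hs : ∀ i, Summable fun n => ((1 / 2 : ℝ) ^ n) • x n i := fun i =>
    Summable.of_norm_bounded summable_geometric_two fun n => by
      rw [norm_smul, Real.norm_of_nonneg (by positivity)]
      exact mul_le_of_le_one_right (by positivity) (hx1 n i)
  have hnn : ∀ n i, 0 ≤ ((1 / 2 : ℝ) ^ n) • x n i := fun n i =>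
    smul_nonneg (by positivity) (hx0 n i)
  let z : Fin m → E := fun i => ∑' n, ((1 / 2 : ℝ) ^ n) • x n i
  have hz : ∀ n i, ((1 / 2 : ℝ) ^ n) • x n i ≤ z i := fun n i =>
    (hs i).le_tsum n fun k _ => hnn k i
  obtain ⟨n, hn⟩ := exists_nat_gt ‖P z‖
  have h1 := hP.mono (hnn n) (hz n)
  have h2 : 0 ≤ P fun i => ((1 / 2 : ℝ) ^ n) • x n i := hP _ (hnn n)
  have h3 : ‖P fun i => ((1 / 2 : ℝ) ^ n) • x n i‖ ≤ ‖P z‖ := by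
    refine norm_le_norm_of_abs_le_abs ?_
    rwa [abs_of_nonneg h2, abs_of_nonneg (h2.trans h1)]
  rw [P.map_smul_univ, norm_smul, Finset.prod_const, Finset.card_univ, Fintype.card_fin,
    Real.norm_of_nonneg (by positivity)] at h3
  have h4 : (((1 / 2 : ℝ) ^ n) ^ m) * (n * (2 ^ n) ^ m) = n := by
    rw [mul_left_comm, ← mul_pow, ← mul_pow]; norm_num
  have h5 := mul_lt_mul_of_pos_left (hx n) (show (0 : ℝ) < ((1 / 2 : ℝ) ^ n) ^ m by positivity)
  rw [h4] at h5
  linarith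

/-- Positive multilinear operators on Banach lattices are automatically continuous. -/
theorem IsPositiveMultilinear.continuous {P : MultilinearMap ℝ (fun _ : Fin m => E) F}
    (hP : IsPositiveMultilinear P) : Continuous P := by
  classical
  obtain ⟨C, hC⟩ := hP.bound_pos
  have hball : ∀ x : Fin m → E, (∀ i, ‖x i‖ ≤ 1) →
      ‖P x‖ ≤ ∑ _s : Finset (Fin m), C := by
    intro x hx
    have h : P x = ∑ s : Finset (Fin m),
        P (s.piecewise (fun i => (x i)⁺) (fun i => -(x i)⁻)) := by
      rw [← P.map_add_univ]; congr 1; funext i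
      simp [← sub_eq_add_neg]
    rw [h]
    refine (norm_sum_le _ _).trans (Finset.sum_le_sum fun s _ => ?_)
    have h1 : s.piecewise (fun i => (x i)⁺) (fun i => -(x i)⁻) =
        fun i => (if i ∈ s then (1 : ℝ) else -1) •
          s.piecewise (fun i => (x i)⁺) (fun i => (x i)⁻) i := by
      funext i
      by_cases hi : i ∈ s <;> simp [hi]
    have h2 : ‖∏ i : Fin m, (if i ∈ s then (1 : ℝ) else -1)‖ = 1 := by
      rw [norm_prod]
      refine Finset.prod_eq_one fun i _ => ?_
      split_ifs <;> simp
    rw [h1, P.map_smul_univ, norm_smul, h2, one_mul]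
    refine hC _ (fun i => ?_) fun i => ?_
    · by_cases hi : i ∈ s
      · simp [hi]
      · simp [hi]
    · refine le_trans (norm_le_norm_of_abs_le_abs ?_) (hx i)
      by_cases hi : i ∈ s
      · simp only [hi, Finset.piecewise_eq_of_mem]
        rw [abs_of_nonneg (posPart_nonneg (x i)), ← posPart_add_negPart (x i)]
        exact le_add_of_nonneg_right (negPart_nonneg _)
      · simp only [hi, not_false_eq_true, Finset.piecewise_eq_of_notMem]
        rw [abs_of_nonneg (negPart_nonneg (x i)), ← posPart_add_negPart (x i)]
        exact le_add_of_nonneg_left (posPart_nonneg _)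
  refine P.continuous_of_bound (∑ _s : Finset (Fin m), C) fun x => ?_
  have hx : x = fun i => ‖x i‖ • (‖x i‖⁻¹ • x i) := by
    funext i
    by_cases hi : x i = 0
    · simp [hi]
    · rw [smul_smul, mul_inv_cancel₀ (norm_ne_zero_iff.2 hi), one_smul]
  conv_lhs => rw [hx]
  rw [P.map_smul_univ, norm_smul, norm_prod, mul_comm]
  simp only [norm_norm]
  refine mul_le_mul_of_nonneg_right (hball _ fun i => ?_)
    (Finset.prod_nonneg fun i _ => norm_nonneg _)
  rw [norm_smul, norm_inv, norm_norm]
  exact inv_mul_le_one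

theorem IsRegularMultilinear.continuous {A : MultilinearMap ℝ (fun _ : Fin m => E) F}
    (hA : IsRegularMultilinear A) : Continuous A := by
  obtain ⟨P, N, hP, hN, rfl⟩ := hA
  exact hP.continuous.sub hN.continuous

/-- A regular multilinear operator between Banach lattices as a continuous multilinear map. -/
def IsRegularMultilinear.toContinuous {A : MultilinearMap ℝ (fun _ : Fin m => E) F}
    (hA : IsRegularMultilinear A) : ContinuousMultilinearMap ℝ (fun _ : Fin m => E) F :=
  { A with cont := hA.continuous }

end Regular

/-! ### The Arens extension -/

section Arens

variable {E F : Type*} [NormedAddCommGroup E] [NormedSpace ℝ E]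
  [NormedAddCommGroup F] [NormedSpace ℝ F]

/-- The operator sending an `(m+1)`-linear form `A` to the `m`-linear form
`(x₁, …, x_m) ↦ v (A (x₁, …, x_m, •))`, where `v` is in the bidual. -/
def arensBar (m : ℕ) (v : StrongDual ℝ (StrongDual ℝ E)) :
    ContinuousMultilinearMap ℝ (fun _ : Fin (m + 1) => E) ℝ →L[ℝ]
      ContinuousMultilinearMap ℝ (fun _ : Fin m => E) ℝ :=
  (ContinuousLinearMap.compContinuousMultilinearMapL ℝ (fun _ : Fin m => E)
      (StrongDual ℝ E) ℝ v).comp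
    (continuousMultilinearCurryRightEquiv ℝ (fun _ : Fin (m + 1) => E)
      ℝ).toContinuousLinearEquiv.toContinuousLinearMap

theorem arensBar_apply (m : ℕ) (v : StrongDual ℝ (StrongDual ℝ E))
    (A : ContinuousMultilinearMap ℝ (fun _ : Fin (m + 1) => E) ℝ) (x : Fin m → E) :
    arensBar m v A x = v (A.curryRight x) := rfl

/-- `arensForm m (v₁, …, v_m)` is the composition `v̄₁ ∘ v̄₂ ∘ ⋯ ∘ v̄_m` on `m`-linear forms
(the last variable is extended first), multilinear in `(v₁, …, v_m)`. For `m = 0` it is the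
identification of `0`-linear forms with scalars. -/
def arensForm : (m : ℕ) → MultilinearMap ℝ (fun _ : Fin m => StrongDual ℝ (StrongDual ℝ E))
    (StrongDual ℝ (ContinuousMultilinearMap ℝ (fun _ : Fin m => E) ℝ))
  | 0 => MultilinearMap.constOfIsEmpty ℝ _
      (ContinuousMultilinearMap.apply ℝ (fun _ : Fin 0 => E) ℝ 0)
  | m + 1 => MultilinearMap.uncurryRight
      (M := fun _ : Fin (m + 1) => StrongDual ℝ (StrongDual ℝ E))
      ((LinearMap.mk₂ ℝ
        (fun (φ : StrongDual ℝ (ContinuousMultilinearMap ℝ (fun _ : Fin m => E) ℝ))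
          (v : StrongDual ℝ (StrongDual ℝ E)) => φ.comp (arensBar m v))
        (fun _ _ _ => rfl) (fun _ _ _ => rfl)
        (fun φ v v' => by
          ext A
          exact φ.map_add (arensBar m v A) (arensBar m v' A))
        (fun c φ v => by
          ext A
          exact φ.map_smul c (arensBar m v A))).compMultilinearMap (arensForm m))

theorem arensForm_zero (v : Fin 0 → StrongDual ℝ (StrongDual ℝ E))
    (A : ContinuousMultilinearMap ℝ (fun _ : Fin 0 => E) ℝ) : arensForm 0 v A = A 0 := rfl

theorem arensForm_succ (m : ℕ) (v : Fin (m + 1) → StrongDual ℝ (StrongDual ℝ E))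
    (A : ContinuousMultilinearMap ℝ (fun _ : Fin (m + 1) => E) ℝ) :
    arensForm (m + 1) v A = arensForm m (Fin.init v) (arensBar m (v (Fin.last m)) A) := rfl

/-- The Arens extension `A^{*[m+1]} : (E**)^m → F**` of a continuous `m`-linear operator,
`A^{*[m+1]}(v₁, …, v_m)(y) = (v̄₁ ∘ ⋯ ∘ v̄_m)(y ∘ A)` for `y` in the dual of `F`. -/
def arensExtension {m : ℕ} (A : ContinuousMultilinearMap ℝ (fun _ : Fin m => E) F) :
    MultilinearMap ℝ (fun _ : Fin m => StrongDual ℝ (StrongDual ℝ E))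
      (StrongDual ℝ (StrongDual ℝ F)) :=
  (ContinuousLinearMap.precomp ℝ
    ((ContinuousLinearMap.compContinuousMultilinearMapL ℝ (fun _ : Fin m => E) F ℝ).flip
      A)).toLinearMap.compMultilinearMap (arensForm m)

theorem arensExtension_apply {m : ℕ} (A : ContinuousMultilinearMap ℝ (fun _ : Fin m => E) F)
    (v : Fin m → StrongDual ℝ (StrongDual ℝ E)) (y : StrongDual ℝ F) :
    arensExtension A v y = arensForm m v (y.compContinuousMultilinearMap A) := rfl

end Arens

/-! ### Arens regularity -/

/-- A bounded operator is weakly compact if the image of the closed unit ball is relatively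
compact for the weak topology. -/
def IsWeaklyCompactOperator {X Y : Type*} [NormedAddCommGroup X] [NormedSpace ℝ X]
    [NormedAddCommGroup Y] [NormedSpace ℝ Y] (T : X →L[ℝ] Y) : Prop :=
  IsCompact (closure (toWeakSpace ℝ Y '' (T '' Metric.closedBall 0 1)))

/-- A normed space `E` is Arens regular if every bounded operator from `E` to its dual is weakly
compact. -/
def IsArensRegular (E : Type*) [NormedAddCommGroup E] [NormedSpace ℝ E] : Prop :=
  ∀ T : E →L[ℝ] StrongDual ℝ E, IsWeaklyCompactOperator T

end

theorem abs_sub_le_add_of_abs_le {G : Type*} [AddCommGroup G] [Lattice G] [IsOrderedAddMonoid G]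
    {a b c d : G} (ha : |a| ≤ c) (hb : |b| ≤ d) : |a - b| ≤ c + d := by
  rw [sub_eq_add_neg]
  exact (abs_add_le a (-b)).trans (add_le_add ha (by rwa [abs_neg]))

/-- Given a pairing of `E` and `Y`, a functional on `Y` that no element of `Y` separates strictly
from a convex subset of `E` is a pointwise limit of points of that set along an ultrafilter. -/
theorem Convex.exists_ultrafilter_tendsto_pairing {E Y : Type*} [AddCommGroup E] [Module ℝ E]
    [AddCommGroup Y] [Module ℝ Y] (B : E →ₗ[ℝ] Y →ₗ[ℝ] ℝ) {s : Set E} (hs : Convex ℝ s)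
    (v : Y →ₗ[ℝ] ℝ) (h : ∀ (y : Y) (u : ℝ), (∀ a ∈ s, B a y < u) → v y ≤ u) :
    ∃ l : Ultrafilter E, s ∈ l ∧ ∀ y, Tendsto (fun a => B a y) l (𝓝 (v y)) := by
  let I : (Y →ₗ[ℝ] ℝ) →ₗ[ℝ] Y →ₗ[ℝ] ℝ := LinearMap.id
  let J : E →ₗ[ℝ] WeakBilin I := B
  let V : WeakBilin I := v
  have hmem : V ∈ closure (J '' s) := by
    by_contra hcon
    obtain ⟨g, u, hg, hu⟩ := geometric_hahn_banach_closed_point (hs.linear_image J).closure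
      isClosed_closure hcon
    obtain ⟨y, rfl⟩ := LinearMap.dualEmbedding_surjective I g
    exact absurd (h y u fun a ha => hg (J a) (subset_closure ⟨a, ha, rfl⟩)) (not_le.2 hu)
  obtain ⟨l, hl, hlv⟩ := mem_closure_iff_ultrafilter.1 hmem
  have hne : (comap J (l : Filter (WeakBilin I)) ⊓ 𝓟 s).NeBot := by
    rw [inf_principal_neBot_iff]
    rintro r ⟨t, ht, htr⟩
    obtain ⟨_, hyt, x, hx, rfl⟩ := l.neBot.nonempty_of_mem (inter_mem ht hl)
    exact ⟨x, htr hyt, hx⟩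
  refine ⟨Ultrafilter.of (comap J l ⊓ 𝓟 s), Ultrafilter.of_le _ (mem_inf_of_right (mem_principal_self _)),
    fun y => ?_⟩
  have h1 : Tendsto (fun z : WeakBilin I => I z y) l (𝓝 (I V y)) :=
    ((WeakBilin.eval_continuous I y).tendsto V).mono_left hlv
  exact h1.comp (tendsto_comap.mono_left ((Ultrafilter.of_le _).trans inf_le_left))

/-- Goldstine's theorem, in terms of ultrafilters. -/
theorem exists_ultrafilter_tendsto_bidual {E : Type*} [NormedAddCommGroup E] [NormedSpace ℝ E]
    (v : StrongDual ℝ (StrongDual ℝ E)) (hv : ‖v‖ ≤ 1) :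
    ∃ l : Ultrafilter E, Metric.closedBall (0 : E) 1 ∈ l ∧
      ∀ f : StrongDual ℝ E, Tendsto (fun x => f x) l (𝓝 (v f)) := by
  refine Convex.exists_ultrafilter_tendsto_pairing (topDualPairing ℝ E).flip
    (convex_closedBall (0 : E) 1) v.toLinearMap fun f u hu => ?_
  have hball : ∀ x : E, ‖x‖ ≤ 1 → f x < u := fun x hx => hu x (by simpa using hx)
  have hu0 : 0 < u := by simpa using hball 0 (by simp)
  have hf : ‖f‖ ≤ u := by
    refine f.opNorm_le_of_unit_norm hu0.le fun x hx => ?_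
    rw [Real.norm_eq_abs, abs_le']
    refine ⟨(hball x hx.le).le, ?_⟩
    simpa using (hball (-x) (by simpa using hx.le)).le
  exact (le_abs_self _).trans ((v.le_of_opNorm_le hv f).trans (by rwa [one_mul]))

/-- The two Arens extensions of the bilinear form `(x, y) ↦ T x y` agree when `T` is weakly
compact. -/
theorem IsWeaklyCompactOperator.bidual_comm {E : Type*} [NormedAddCommGroup E] [NormedSpace ℝ E]
    {T : E →L[ℝ] StrongDual ℝ E} (hT : IsWeaklyCompactOperator T)
    (v t : StrongDual ℝ (StrongDual ℝ E)) :
    v (t.comp T) = t (v.comp T.flip) := by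
  wlog hv : ‖v‖ ≤ 1 generalizing v
  · have hv0 : ‖v‖ ≠ 0 := fun h => hv (by simp [h])
    have h := this (‖v‖⁻¹ • v) ((v.opNorm_smul_le _).trans
      (by rw [norm_inv, Real.norm_of_nonneg (norm_nonneg v), inv_mul_cancel₀ hv0]))
    rw [ContinuousLinearMap.smul_comp, map_smul, smul_apply] at h
    exact smul_right_injective ℝ (inv_ne_zero hv0) h
  obtain ⟨l, hl, hlv⟩ := exists_ultrafilter_tendsto_bidual v hv
  let W := toWeakSpace ℝ (StrongDual ℝ E)
  obtain ⟨g, -, hg⟩ := hT.ultrafilter_le_nhds (l.map fun x => W (T x)) (by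
    rw [le_principal_iff]
    change (fun x => W (T x)) ⁻¹' _ ∈ l
    exact mem_of_superset hl fun x hx => subset_closure ⟨_, ⟨x, hx, rfl⟩, rfl⟩)
  have key : ∀ s : StrongDual ℝ (StrongDual ℝ E), v (s.comp T) = s (W.symm g) := fun s => by
    have hcont : Continuous fun y : WeakSpace ℝ (StrongDual ℝ E) => s (W.symm y) :=
      WeakBilin.eval_continuous (topDualPairing ℝ (StrongDual ℝ E)).flip s
    have h1 : Tendsto (fun x => W (T x)) l (𝓝 g) := hg
    have h2 : Tendsto (fun x => s (T x)) l (𝓝 (s (W.symm g))) := (hcont.tendsto g).comp h1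
    exact tendsto_nhds_unique (hlv (s.comp T)) h2
  have hgT : W.symm g = v.comp T.flip := by
    ext y
    exact (key (NormedSpace.inclusionInDoubleDual ℝ E y)).symm
  rw [key, hgT]

section ArensRegular

variable {E : Type*} [NormedAddCommGroup E] [NormedSpace ℝ E]

/-- On an Arens regular space, extending a dual-valued multilinear operator through its value
amounts to evaluation at a functional. -/
theorem IsArensRegular.exists_arensForm_comp (hE : IsArensRegular E) (m : ℕ)
    (w : Fin m → StrongDual ℝ (StrongDual ℝ E))
    (C : ContinuousMultilinearMap ℝ (fun _ : Fin m => E) (StrongDual ℝ E)) :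
    ∃ ψ : StrongDual ℝ E, ∀ t : StrongDual ℝ (StrongDual ℝ E),
      arensForm m w (t.compContinuousMultilinearMap C) = t ψ := by
  induction m with
  | zero => exact ⟨C 0, fun t => rfl⟩
  | succ m ih =>
    let v := w (Fin.last m)
    let L : (E →L[ℝ] StrongDual ℝ E) →L[ℝ] StrongDual ℝ E :=
      (ContinuousLinearMap.compL ℝ E (StrongDual ℝ E) ℝ v).comp
        (ContinuousLinearMap.flipₗᵢ ℝ E E ℝ).toContinuousLinearEquiv.toContinuousLinearMap
    obtain ⟨ψ, hψ⟩ := ih (Fin.init w) (L.compContinuousMultilinearMap C.curryRight)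
    refine ⟨ψ, fun t => ?_⟩
    rw [← hψ, arensForm_succ]
    congr 1
    ext x
    exact (hE (C.curryRight x)).bidual_comm v t

/-- On an Arens regular space, the extension of a multilinear form is separately weak-star
continuous. -/
theorem IsArensRegular.exists_arensForm_update (hE : IsArensRegular E) (m : ℕ)
    (B : ContinuousMultilinearMap ℝ (fun _ : Fin m => E) ℝ)
    (w : Fin m → StrongDual ℝ (StrongDual ℝ E)) (j : Fin m) :
    ∃ ψ : StrongDual ℝ E, ∀ t : StrongDual ℝ (StrongDual ℝ E),
      arensForm m (Function.update w j t) B = t ψ := by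
  induction m with
  | zero => exact j.elim0
  | succ m ih =>
    induction j using Fin.lastCases with
    | last =>
      obtain ⟨ψ, hψ⟩ := hE.exists_arensForm_comp m (Fin.init w) B.curryRight
      refine ⟨ψ, fun t => ?_⟩
      rw [← hψ, arensForm_succ, Fin.init_update_last, Function.update_self]
      rfl
    | cast i =>
      obtain ⟨ψ, hψ⟩ := ih (arensBar m (w (Fin.last m)) B) (Fin.init w) i
      refine ⟨ψ, fun t => ?_⟩
      rw [← hψ, arensForm_succ, Fin.init_update_castSucc,
        Function.update_of_ne (Fin.castSucc_lt_last i).ne']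

end ArensRegular

section Positive

variable {E F : Type*} [NormedAddCommGroup E] [NormedSpace ℝ E] [Lattice E]
  [IsOrderedAddMonoid E] [HasSolidNorm E]
  [NormedAddCommGroup F] [NormedSpace ℝ F] [Lattice F] [IsOrderedAddMonoid F] [HasSolidNorm F]
  {m : ℕ}

theorem arensForm_nonneg (m : ℕ) (B : ContinuousMultilinearMap ℝ (fun _ : Fin m => E) ℝ)
    (hB : ∀ x : Fin m → E, (∀ i, 0 ≤ x i) → 0 ≤ B x)
    (v : Fin m → StrongDual ℝ (StrongDual ℝ E)) (hv : ∀ i, 0 ≤ v i) :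
    0 ≤ arensForm m v B := by
  induction m with
  | zero => exact hB 0 fun i => le_rfl
  | succ m ih =>
    rw [arensForm_succ]
    refine ih _ (fun x hx => ?_) _ fun i => hv _
    rw [arensBar_apply]
    refine hv (Fin.last m) _ fun y hy => hB _ fun i => ?_
    induction i using Fin.lastCases with
    | last => simpa using hy
    | cast i => simpa using hx i

theorem arensExtension_isPositive {A : ContinuousMultilinearMap ℝ (fun _ : Fin m => E) F}
    (hA : IsPositiveMultilinear A.toMultilinearMap) :
    IsPositiveMultilinear (E := StrongDual ℝ (StrongDual ℝ E))
      (F := StrongDual ℝ (StrongDual ℝ F)) (arensExtension A) := fun v hv y hy => by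
  rw [arensExtension_apply]
  exact arensForm_nonneg m _ (fun x hx => by simpa using hy (A x) (hA x hx)) v hv

theorem IsPositiveMultilinear.abs_apply_le {P : MultilinearMap ℝ (fun _ : Fin m => E) F}
    (hP : IsPositiveMultilinear P) (x : Fin m → E) : |P x| ≤ P fun i => |x i| := by
  classical
  have h1 : P x = ∑ s : Finset (Fin m),
      P (s.piecewise (fun i => (x i)⁺) (fun i => -(x i)⁻)) := by
    rw [← P.map_add_univ]; congr 1; funext i
    simp [← sub_eq_add_neg]
  have h2 : (P fun i => |x i|) = ∑ s : Finset (Fin m),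
      P (s.piecewise (fun i => (x i)⁺) (fun i => (x i)⁻)) := by
    rw [← P.map_add_univ]; congr 1; funext i
    exact (posPart_add_negPart (x i)).symm
  have h3 : ∀ s : Finset (Fin m), |P (s.piecewise (fun i => (x i)⁺) (fun i => -(x i)⁻))| ≤
      P (s.piecewise (fun i => (x i)⁺) (fun i => (x i)⁻)) := fun s => by
    have hs : s.piecewise (fun i => (x i)⁺) (fun i => -(x i)⁻) =
        fun i => (if i ∈ s then (1 : ℝ) else -1) •
          s.piecewise (fun i => (x i)⁺) (fun i => (x i)⁻) i := by
      funext i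
      by_cases hi : i ∈ s <;> simp [hi]
    have h0 : 0 ≤ P (s.piecewise (fun i => (x i)⁺) (fun i => (x i)⁻)) := hP _ fun i => by
      by_cases hi : i ∈ s
      · simp [hi]
      · simp [hi]
    have hsign : (∏ i : Fin m, (if i ∈ s then (1 : ℝ) else -1)) = 1 ∨
        (∏ i : Fin m, (if i ∈ s then (1 : ℝ) else -1)) = -1 := by
      rw [← abs_eq zero_le_one, Finset.abs_prod]
      exact Finset.prod_eq_one fun i _ => by split_ifs <;> simp
    rw [hs, P.map_smul_univ]
    rcases hsign with h | h <;> rw [h]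
    · rw [one_smul, abs_of_nonneg h0]
    · rw [neg_smul, one_smul, abs_neg, abs_of_nonneg h0]
  rw [h1, h2]
  exact (Finset.le_sum_of_subadditive _ abs_zero.le abs_add_le _ _).trans (Finset.sum_le_sum fun s _ => h3 s)

/-- A net in the dual that decreases to zero converges pointwise to zero. -/
theorem DecreasesToZero.tendsto_apply {Ω : Type*} [Preorder Ω] [IsDirectedOrder Ω] [Nonempty Ω]
    {y : Ω → StrongDual ℝ E} (hy : DecreasesToZero y) (x : E) :
    Tendsto (fun α => y α x) atTop (𝓝 0) := by
  have hy0 : ∀ α, 0 ≤ y α := fun α => hy.2.1 ⟨α, rfl⟩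
  have hpos : ∀ x : E, 0 ≤ x → ∃ c, Tendsto (fun α => y α x) atTop (𝓝 c) := fun x hx =>
    ⟨_, tendsto_atTop_ciInf (fun α β h => hy.1 h x hx)
      ⟨0, by rintro _ ⟨α, rfl⟩; exact hy0 α x hx⟩⟩
  have hall : ∀ x : E, ∃ c, Tendsto (fun α => y α x) atTop (𝓝 c) := fun x => by
    obtain ⟨a, ha⟩ := hpos x⁺ (posPart_nonneg x)
    obtain ⟨b, hb⟩ := hpos x⁻ (negPart_nonneg x)
    refine ⟨a - b, (ha.sub hb).congr fun α => ?_⟩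
    rw [← map_sub, posPart_sub_negPart]
  choose g hg using hall
  let G : E →ₗ[ℝ] ℝ := linearMapOfTendsto g (fun α => (y α).toLinearMap) (tendsto_pi_nhds.2 hg)
  obtain ⟨α₀⟩ := ‹Nonempty Ω›
  have hle : ∀ α, ∀ x : E, 0 ≤ x → g x ≤ y α x := fun α x hx =>
    le_of_tendsto (hg x) ((eventually_ge_atTop α).mono fun β hβ => hy.1 hβ x hx)
  have hbound : ∀ x, ‖G x‖ ≤ ‖y α₀‖ * ‖x‖ := fun x => by
    refine le_of_tendsto (hg x).norm ((eventually_ge_atTop α₀).mono fun β hβ => ?_)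
    refine ((y β).le_opNorm x).trans (mul_le_mul_of_nonneg_right ?_ (norm_nonneg x))
    refine norm_le_norm_of_abs_le_abs ?_
    rw [abs_of_nonneg (hy0 β), abs_of_nonneg (hy0 α₀)]
    exact hy.1 hβ
  have hG0 : G.mkContinuous _ hbound ≤ 0 := hy.2.2 (by
    rintro _ ⟨α, rfl⟩
    exact hle α)
  have hzero : ∀ x : E, 0 ≤ x → g x = 0 := fun x hx =>
    le_antisymm (hG0 x hx) (ge_of_tendsto' (hg x) fun α => hy0 α x hx)
  have hgx : g x = 0 := by
    have h : G x = G x⁺ - G x⁻ := by rw [← map_sub, posPart_sub_negPart]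
    have h1 : G x⁺ = 0 := hzero _ (posPart_nonneg x)
    have h2 : G x⁻ = 0 := hzero _ (negPart_nonneg x)
    rw [h1, h2, sub_zero] at h
    exact h
  exact hgx ▸ hg x

end Positive

theorem mainTheorem11 {E : Type u}
    [NormedAddCommGroup E] [NormedSpace ℝ E] [Lattice E] [IsOrderedAddMonoid E]
    [IsOrderedModule ℝ E] [HasSolidNorm E] [CompleteSpace E]
    (hE : IsArensRegular E)
    {F : Type v}
    [NormedAddCommGroup F] [NormedSpace ℝ F] [Lattice F] [IsOrderedAddMonoid F]
    [IsOrderedModule ℝ F] [HasSolidNorm F] [CompleteSpace F]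
    (m : ℕ) (A : MultilinearMap ℝ (fun _ : Fin m => E) F) (hA : IsRegularMultilinear A) :
    IsSeparatelyOrderContinuous.{w} (X := StrongDual ℝ (StrongDual ℝ E))
      (Y := StrongDual ℝ (StrongDual ℝ F)) (arensExtension hA.toContinuous) := by
  obtain ⟨P, N, hP, hN, rfl⟩ := id hA
  let P' : ContinuousMultilinearMap ℝ (fun _ : Fin m => E) F := { P with cont := hP.continuous }
  let N' : ContinuousMultilinearMap ℝ (fun _ : Fin m => E) F := { N with cont := hN.continuous }
  have hP' : IsPositiveMultilinear (E := StrongDual ℝ (StrongDual ℝ E))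
      (F := StrongDual ℝ (StrongDual ℝ F)) (arensExtension P') := arensExtension_isPositive hP
  have hN' : IsPositiveMultilinear (E := StrongDual ℝ (StrongDual ℝ E))
      (F := StrongDual ℝ (StrongDual ℝ F)) (arensExtension N') := arensExtension_isPositive hN
  have hsub : ∀ v, arensExtension hA.toContinuous v = arensExtension P' v - arensExtension N' v :=
    fun v => by
      ext y
      rw [sub_apply, arensExtension_apply, arensExtension_apply, arensExtension_apply, ← map_sub]
      congr 1
      ext x
      exact map_sub y (P x) (N x)
  intro j w Ω _ _ _ x ⟨y, hy, hxy⟩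
  have hy0 : ∀ α, 0 ≤ y α := fun α => hy.2.1 ⟨α, rfl⟩
  let u : StrongDual ℝ (StrongDual ℝ E) → Fin m → StrongDual ℝ (StrongDual ℝ E) :=
    fun t => Function.update (fun i => |w i|) j t
  have hu0 : ∀ t, 0 ≤ t → ∀ i, 0 ≤ u t i := fun t ht i => by
    by_cases hi : i = j
    · subst hi; simpa [u] using ht
    · exact (abs_nonneg (w i)).trans_eq (Function.update_of_ne hi t fun i => |w i|).symm
  have hu : ∀ s t, s ≤ t → ∀ i, u s i ≤ u t i := fun s t hst =>
    update_le_update_iff.2 ⟨hst, fun _ _ => le_rfl⟩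
  have habs : ∀ α i, |Function.update w j (x α) i| ≤ u (y α) i := fun α i => by
    by_cases hi : i = j
    · subst hi; simpa [u] using hxy α
    · simp [u, hi]
  refine ⟨fun α => arensExtension P' (u (y α)) + arensExtension N' (u (y α)),
    ⟨fun α β h => ?_, ?_, fun c hc => ?_⟩, fun α => ?_⟩
  · exact add_le_add (hP'.mono (hu0 _ (hy0 β)) (hu _ _ (hy.1 h)))
      (hN'.mono (hu0 _ (hy0 β)) (hu _ _ (hy.1 h)))
  · rintro _ ⟨α, rfl⟩
    exact add_nonneg (hP' _ (hu0 _ (hy0 α))) (hN' _ (hu0 _ (hy0 α)))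
  · intro φ hφ
    obtain ⟨ψ, hψ⟩ := hE.exists_arensForm_update m (φ.compContinuousMultilinearMap P')
      (fun i => |w i|) j
    obtain ⟨χ, hχ⟩ := hE.exists_arensForm_update m (φ.compContinuousMultilinearMap N')
      (fun i => |w i|) j
    have hlim : Tendsto (fun α => y α ψ + y α χ) atTop (𝓝 0) := by
      simpa using (hy.tendsto_apply ψ).add (hy.tendsto_apply χ)
    refine ge_of_tendsto' hlim fun α => ?_
    rw [← hψ, ← hχ]
    exact hc ⟨α, rfl⟩ φ hφ
  · rw [sub_zero]
    change |arensExtension hA.toContinuous (Function.update w j (x α))| ≤ _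
    rw [hsub]
    exact abs_sub_le_add_of_abs_le
      ((hP'.abs_apply_le _).trans (hP'.mono (fun i => abs_nonneg _) (habs α)))
      ((hN'.abs_apply_le _).trans (hN'.mono (fun i => abs_nonneg _) (habs α)))
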